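/- Work in the full type structure over $\mathbb{N}$, and let "computable" mean computable by Kleene's schemes S1–S9. Let $\exists^2$ be the functional with $\exists^2(f)=0$ if $f\in\mathbb{N}^{\mathbb{N}}$ has a zero and $\exists^2(f)=1$ otherwise. Let $\mathrm{IND}$ be the type-3 functional that maps $F:2^{\mathbb{N}}\to 2^{\mathbb{N}}$ to the inductive closure of the operator $\Gamma(A)=A\cup F(A)$ on subsets of $\mathbb{N}$, i.e. to $\Gamma_{\alpha_0}$, where $\Gamma_\alpha=\Gamma\big(\bigcup_{\beta<\alpha}\Gamma_\beta\big)$ for all ordinals $\alpha$, and $\Gamma_{\alpha_0+1}=\Gamma_{\alpha_0}$ ($F$ need not be monotone). Real numbers are coded by elements of $\mathbb{N}^{\mathbb{N}}$, read as fast-converging sequences of (codes of) rationals; by the usual convention (replace a sequence $q$ by the constant value $q_k$ from the first $k$ on with $|q_k-q_{k+1}|\ge 2^{-(k+1)}$) every element of $\mathbb{N}^{\mathbb{N}}$ codes a real. A function $\mathbb{R}\to\mathbb{R}$ is given by some $Y:\mathbb{N}^{\mathbb{N}}\to\mathbb{N}^{\mathbb{N}}$ that maps codes of equal reals to codes of equal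 reals, and such a $Y$ represents the set $\{x\in\mathbb{R}: Y(x)>0\}$, for which we write $Y$ as well. **Theorem.** There is a total type-3 functional $\xi$, which maps every sequence $(Y_n)_{n\in\mathbb{N}}$ of functionals $Y_n:\mathbb{N}^{\mathbb{N}}\to\mathbb{N}^{\mathbb{N}}$ to an element $\xi(\lambda n.Y_n)$ of $\mathbb{N}^{\mathbb{N}}$, such that 1. $\xi$ is computable in $\mathrm{IND}$ and $\exists^2$: there is one index $e$ such that, for all sequences $(Y_n)_{n\in\mathbb{N}}$ and all $m\in\mathbb{N}$, the computation $\{e\}(\mathrm{IND},\exists^2,\lambda n.Y_n,m)$ terminates with value $\xi(\lambda n.Y_n)(m)$; 2. whenever every $Y_n$ represents a function $\mathbb{R}\to\mathbb{R}$ and the represented sets $Y_n\subseteq\mathbb{R}$ are all open and dense, the real coded by $\xi(\lambda n.Y_n)$ lies in $\bigcap_{n\in\mathbb{N}}Y_n$. -/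

import Mathlib

/-! ### The functional of non-monotone inductive definitions -/

/-- The transfinite stages `Γ_α = Γ (⋃_{β < α} Γ_β)` of an operator on sets of numbers. -/
noncomputable def inductiveStage (Γ : Set ℕ → Set ℕ) (α : Ordinal.{0}) : Set ℕ :=
  Γ (⋃ β : Set.Iio α, inductiveStage Γ β.1)
termination_by α
decreasing_by exact β.2

/-- If `A ⊆ Γ A` for all `A`, then the stages become stationary. -/
theorem exists_inductiveStage_succ_eq (Γ : Set ℕ → Set ℕ) (hΓ : ∀ A, A ⊆ Γ A) :
    ∃ α : Ordinal.{0}, inductiveStage Γ (Order.succ α) = inductiveStage Γ α := by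
  have mono : ∀ {α β : Ordinal.{0}}, α < β → inductiveStage Γ α ⊆ inductiveStage Γ β := by
    intro α β h
    rw [inductiveStage.eq_def Γ β]
    exact (Set.subset_iUnion (fun γ : Set.Iio β => inductiveStage Γ γ.1) ⟨α, h⟩).trans (hΓ _)
  have key : ∀ {α β : Ordinal.{0}}, α < β → inductiveStage Γ α = inductiveStage Γ β →
      inductiveStage Γ (Order.succ α) = inductiveStage Γ α := by
    intro α β h e
    refine Set.Subset.antisymm ?_ (mono (Order.lt_succ α))
    rcases (Order.succ_le_of_lt h).eq_or_lt with h' | h'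
    · rw [h', e]
    · exact (mono h').trans e.ge
  have hni := not_injective_of_ordinal (inductiveStage Γ)
  simp only [Function.Injective, not_forall] at hni
  obtain ⟨α, β, e, hne⟩ := hni
  rcases lt_or_gt_of_ne hne with h | h
  · exact ⟨α, key h e⟩
  · exact ⟨β, key h e.symm⟩

/-- The inductive closure: the stage `Γ_{α₀}` for the (least) `α₀` with `Γ_{α₀ + 1} = Γ_{α₀}`. It is
meant for `Γ` with `A ⊆ Γ A` for all `A`, for which such an `α₀` exists. -/
noncomputable def inductiveClosure (Γ : Set ℕ → Set ℕ) : Set ℕ :=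
  inductiveStage Γ (sInf {α : Ordinal.{0} | inductiveStage Γ (Order.succ α) = inductiveStage Γ α})

open Classical in
/-- The characteristic function of a set of numbers. -/
noncomputable def charFun (A : Set ℕ) : ℕ → ℕ := fun n => if n ∈ A then 1 else 0

/-- The type-three functional `IND`: the inductive closure of `A ↦ A ∪ F A`, where sets of numbers
are given by characteristic functions (and `F f` is read as the set `{n | F f n > 0}`). -/
noncomputable def IND (F : (ℕ → ℕ) → (ℕ → ℕ)) : ℕ → ℕ :=
  charFun (inductiveClosure fun A => A ∪ {n | 0 < F (charFun A) n})

open Classical in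
/-- The functional `∃²`: the value at `f` is `0` if `f` has a zero, and `1` otherwise. -/
noncomputable def existsTwo (f : ℕ → ℕ) : ℕ := if ∃ n, f n = 0 then 0 else 1

/-! ### Kleene computability (S1-S9) -/

/-- The sequence number `⟨k₀, …, kᵢ⟩`, an injective coding of finite sequences of numbers. -/
def seqNum (l : List ℕ) : ℕ := Encodable.encode l

/-- `KleeneEval E I Y e a f c` says that Kleene's computation `{e}(E, I, Y, a, f)` terminates with
value `c`. Here `E` (type 2), `I` (type 3) and the sequence `Y` of type `1 → 1` functionals are the
arguments of type at least two, which are the same in all subcomputations, `a` lists the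
arguments of type 0, and `f` those of type 1. Clause S8 is given by direct application of the
functionals `E`, `Y`, `I`, instead of first coding these in the pure types; as always, it needs the
functional that is the argument to be total. -/
inductive KleeneEval (E : (ℕ → ℕ) → ℕ) (I : ((ℕ → ℕ) → (ℕ → ℕ)) → (ℕ → ℕ))
    (Y : ℕ → (ℕ → ℕ) → (ℕ → ℕ)) : ℕ → List ℕ → List (ℕ → ℕ) → ℕ → Prop
  /-- Successor. -/
  | S1 (x : ℕ) (a : List ℕ) (f : List (ℕ → ℕ)) :
      KleeneEval E I Y (seqNum [1]) (x :: a) f (x + 1)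
  /-- Constants. -/
  | S2 (q : ℕ) (a : List ℕ) (f : List (ℕ → ℕ)) :
      KleeneEval E I Y (seqNum [2, q]) a f q
  /-- Projection. -/
  | S3 (x : ℕ) (a : List ℕ) (f : List (ℕ → ℕ)) :
      KleeneEval E I Y (seqNum [3]) (x :: a) f x
  /-- Composition `{g}({h}(a, f), a, f)`. -/
  | S4 (g h x c : ℕ) (a : List ℕ) (f : List (ℕ → ℕ)) :
      KleeneEval E I Y h a f x → KleeneEval E I Y g (x :: a) f c →
      KleeneEval E I Y (seqNum [4, g, h]) a f c
  /-- Primitive recursion, base case. -/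
  | S5_zero (g h c : ℕ) (a : List ℕ) (f : List (ℕ → ℕ)) :
      KleeneEval E I Y g a f c →
      KleeneEval E I Y (seqNum [5, g, h]) (0 :: a) f c
  /-- Primitive recursion, successor case. -/
  | S5_succ (g h x y c : ℕ) (a : List ℕ) (f : List (ℕ → ℕ)) :
      KleeneEval E I Y (seqNum [5, g, h]) (x :: a) f y →
      KleeneEval E I Y h (x :: y :: a) f c →
      KleeneEval E I Y (seqNum [5, g, h]) ((x + 1) :: a) f c
  /-- Permutation: an argument of type 0 is moved to the front. -/
  | S6_zero (g x c : ℕ) (a b : List ℕ) (f : List (ℕ → ℕ)) :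
      KleeneEval E I Y g (x :: (a ++ b)) f c →
      KleeneEval E I Y (seqNum [6, 0, a.length, g]) (a ++ x :: b) f c
  /-- Permutation: an argument of type 1 is moved to the front. -/
  | S6_one (g c : ℕ) (φ : ℕ → ℕ) (a : List ℕ) (f h : List (ℕ → ℕ)) :
      KleeneEval E I Y g a (φ :: (f ++ h)) c →
      KleeneEval E I Y (seqNum [6, 1, f.length, g]) a (f ++ φ :: h) c
  /-- Application of an argument of type 1. -/
  | S7 (x : ℕ) (φ : ℕ → ℕ) (a : List ℕ) (f : List (ℕ → ℕ)) :
      KleeneEval E I Y (seqNum [7]) (x :: a) (φ :: f) (φ x)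
  /-- Application of `E`: the value is `E(λt.{d}(t, a, f))`. -/
  | S8_E (d : ℕ) (h : ℕ → ℕ) (a : List ℕ) (f : List (ℕ → ℕ)) :
      (∀ t, KleeneEval E I Y d (t :: a) f (h t)) →
      KleeneEval E I Y (seqNum [8, 0, d]) a f (E h)
  /-- Application of `Y`: the value is `Y_n(λt.{d}(t, n, m, a, f))(m)`. -/
  | S8_Y (d n m : ℕ) (h : ℕ → ℕ) (a : List ℕ) (f : List (ℕ → ℕ)) :
      (∀ t, KleeneEval E I Y d (t :: n :: m :: a) f (h t)) →
      KleeneEval E I Y (seqNum [8, 1, d]) (n :: m :: a) f (Y n h m)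
  /-- Application of `I`: the value is `I(λφ.λt.{d}(t, m, a, φ, f))(m)`. -/
  | S8_I (d m : ℕ) (G : (ℕ → ℕ) → (ℕ → ℕ)) (a : List ℕ) (f : List (ℕ → ℕ)) :
      (∀ φ t, KleeneEval E I Y d (t :: m :: a) (φ :: f) (G φ t)) →
      KleeneEval E I Y (seqNum [8, 2, d]) (m :: a) f (I G m)
  /-- Enumeration: `{b}(a, f)` from the arguments `b, a, a', f, f'`. -/
  | S9 (b c : ℕ) (a a' : List ℕ) (f f' : List (ℕ → ℕ)) :
      KleeneEval E I Y b a f c →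
      KleeneEval E I Y (seqNum [9, a.length, f.length]) (b :: (a ++ a')) (f ++ f') c

/-- The (total) functional `ξ`, which maps sequences of functionals of type `1 → 1` to functions, is
computable in `E` and `I`: one index `e` gives `ξ(Y)(m) = {e}(E, I, Y, m)` for all `Y` and `m`,
these computations being all terminating. -/
def KleeneComputableIn (E : (ℕ → ℕ) → ℕ) (I : ((ℕ → ℕ) → (ℕ → ℕ)) → (ℕ → ℕ))
    (ξ : (ℕ → (ℕ → ℕ) → (ℕ → ℕ)) → (ℕ → ℕ)) : Prop :=
  ∃ e : ℕ, ∀ (Y : ℕ → (ℕ → ℕ) → (ℕ → ℕ)) (m : ℕ), KleeneEval E I Y e [m] [] (ξ Y m)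

/-! ### Reals, functions on the reals and sets of reals in Baire space -/

/-- The coding of the rationals as signed quotients: a pair `(i, j)` stands for `(i/2)/(j+1)` if `i`
is even, and for `-((i+1)/2)/(j+1)` if `i` is odd. -/
def ratOfCode (c : ℕ) : ℚ :=
  if c.unpair.1 % 2 = 0 then ((c.unpair.1 / 2 : ℕ) : ℚ) / (c.unpair.2 + 1)
  else -(((c.unpair.1 + 1) / 2 : ℕ) : ℚ) / (c.unpair.2 + 1)

/-- The hat function: the sequence `q` itself as long as `|q_k - q_{k+1}| < 2^{-(k+1)}`, and constant
from the first `k` on where this fails. So the result is always fast-converging. -/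
def hatSeq (q : ℕ → ℚ) : ℕ → ℚ
  | 0 => q 0
  | n + 1 => if ∀ k ≤ n, |q k - q (k + 1)| < 1 / 2 ^ (k + 1) then q (n + 1) else hatSeq q n

/-- The real coded by an element of Baire space, read as a sequence of codes of rationals. -/
noncomputable def realOfCode (f : ℕ → ℕ) : ℝ :=
  Filter.limUnder Filter.atTop fun n => ((hatSeq (fun k => ratOfCode (f k)) n : ℚ) : ℝ)

/-- The limit in `realOfCode` always exists. -/
theorem tendsto_realOfCode (f : ℕ → ℕ) :
    Filter.Tendsto (fun n => ((hatSeq (fun k => ratOfCode (f k)) n : ℚ) : ℝ)) Filter.atTop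
      (nhds (realOfCode f)) := by
  refine CauchySeq.tendsto_limUnder (cauchySeq_of_le_geometric (1 / 2 : ℝ) (1 / 2) (by norm_num) ?_)
  intro n
  rw [Real.dist_eq]
  set q : ℕ → ℚ := fun k => ratOfCode (f k)
  have stable : ∀ n, (∀ k < n, |q k - q (k + 1)| < 1 / 2 ^ (k + 1)) → hatSeq q n = q n := by
    intro n h
    cases n with
    | zero => rfl
    | succ n => exact if_pos fun k hk => h k (Nat.lt_succ_of_le hk)
  have hq : |hatSeq q n - hatSeq q (n + 1)| ≤ 1 / 2 * (1 / 2) ^ n := by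
    by_cases h : ∀ k ≤ n, |q k - q (k + 1)| < 1 / 2 ^ (k + 1)
    · rw [stable n fun k hk => h k hk.le, stable (n + 1) fun k hk => h k (Nat.le_of_lt_succ hk)]
      refine (h n le_rfl).le.trans (le_of_eq ?_)
      rw [one_div_pow, pow_succ]
      field_simp
    · have : hatSeq q (n + 1) = hatSeq q n := if_neg h
      rw [this, sub_self, abs_zero]
      positivity
  have := (Rat.cast_le (K := ℝ)).mpr hq
  push_cast at this
  exact this

/-- `Φ` represents a function from the reals to the reals: equal reals are mapped to equal reals. -/
def RepresentsRealFunction (Φ : (ℕ → ℕ) → (ℕ → ℕ)) : Prop :=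
  ∀ f g : ℕ → ℕ, realOfCode f = realOfCode g → realOfCode (Φ f) = realOfCode (Φ g)

/-- The set of the reals `x` with `Φ(x) > 0`. -/
def representedSet (Φ : (ℕ → ℕ) → (ℕ → ℕ)) : Set ℝ :=
  {x | ∃ f : ℕ → ℕ, realOfCode f = x ∧ 0 < realOfCode (Φ f)}

/-! The inductive definition learns which choices of balls were wrong. Let `A` be a set of pairs
`(b, n)`, read as "ball `b` is excluded at `n`". Searching step by step for the first small ball
near the previous centre that is not excluded at `n` gives nested balls, whose centres converge to a
real `x`. One step of the operator excludes the `n`-th choice for each `n` with `x ∉ Y n`.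

Every excluded ball fails to be a subset of `Y n`: it contains `x`, and `x ∉ Y n`. This invariant
passes through all stages (`inductiveClosure_subset`), although the operator is not monotone. Under
it the search succeeds, since by openness and density there are balls inside `Y n`, and these are
never excluded (`nextBall_spec`). The closure is closed under the operator
(`subset_inductiveClosure`). If its own limit missed some `Y n`, the `n`-th choice would be
excluded, but choices are made among balls that are not. So `x` lies in all `Y n`.

For computability, positivity of a coded real is arithmetical, hence decidable by `∃²`, which also
makes unbounded search total. The operator is therefore computable for arbitrary `Y` and all `φ`, as
an application of `IND` requires. Since S4 prepends values and deletes nothing, indices are built to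
work in front of arbitrary leftover arguments. -/

open Encodable

/-! ### Kleene indices for primitive recursive functions -/

section Indices

variable (E : (ℕ → ℕ) → ℕ) (I : ((ℕ → ℕ) → (ℕ → ℕ)) → (ℕ → ℕ))

/-- Moving a block of arguments in front of the block that precedes it. -/
theorem exists_index_swap_blocks (m : ℕ) : ∀ e d : ℕ, ∃ e' : ℕ,
    ∀ (Y : ℕ → (ℕ → ℕ) → (ℕ → ℕ)) (p v a : List ℕ) (f : List (ℕ → ℕ)) (c : ℕ),
      p.length = d → v.length = m →
      KleeneEval E I Y e (v ++ (p ++ a)) f c → KleeneEval E I Y e' (p ++ (v ++ a)) f c := by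
  induction m with
  | zero =>
    refine fun e d => ⟨e, fun Y p v a f c _ hv h => ?_⟩
    rw [List.length_eq_zero_iff] at hv
    simpa [hv] using h
  | succ m ih =>
    intro e d
    -- One use of S6 moves the last entry of `v` in front of `p`; it then counts as part of `p`,
    -- hence `d + 1`.
    obtain ⟨e', he'⟩ := ih e (d + 1)
    refine ⟨seqNum [6, 0, d + m, e'], fun Y p v a f c hp hv h => ?_⟩
    obtain ⟨v', x, rfl⟩ : ∃ v' x, v = v' ++ [x] :=
      ⟨v.dropLast, v.getLast (by rintro rfl; simp at hv), (List.dropLast_append_getLast _).symm⟩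
    have hv' : v'.length = m := by simpa using hv
    have := he' Y (x :: p) v' a f c (by simp [hp]) hv' (by simpa using h)
    have h6 := KleeneEval.S6_zero e' x c (p ++ v') a f (by simpa using this)
    simpa [hp, hv'] using h6

/-- Generalized composition: the values of finitely many functions of the arguments `v` are put in
front of the other arguments. -/
theorem exists_index_push_values (m : ℕ) (n : ℕ) : ∀ (g : Fin n → List.Vector ℕ m → ℕ),
    (∀ i, ∃ e, ∀ (Y : ℕ → (ℕ → ℕ) → (ℕ → ℕ)) (v : List.Vector ℕ m) (a : List ℕ)
      (f : List (ℕ → ℕ)), KleeneEval E I Y e (v.toList ++ a) f (g i v)) →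
    ∀ e d : ℕ, ∃ e' : ℕ, ∀ (Y : ℕ → (ℕ → ℕ) → (ℕ → ℕ)) (v : List.Vector ℕ m)
      (p a : List ℕ) (f : List (ℕ → ℕ)) (c : ℕ),
      p.length = d → KleeneEval E I Y e ((List.ofFn fun i => g i v) ++ (p ++ (v.toList ++ a))) f c →
      KleeneEval E I Y e' (p ++ (v.toList ++ a)) f c := by
  induction n with
  | zero => exact fun g _ e d => ⟨e, fun Y v p a f c _ h => by simpa using h⟩
  | succ n ih =>
    intro g hg e d
    obtain ⟨e₀, he₀⟩ := hg 0
    -- The value of `g 0` has to end up first, so it is computed last, when `n` values and the block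
    -- `p` already precede `v`.
    obtain ⟨e₁, he₁⟩ := exists_index_swap_blocks E I m e₀ (n + d)
    obtain ⟨e', he'⟩ := ih (fun i => g i.succ) (fun i => hg i.succ) (seqNum [4, e, e₁]) d
    refine ⟨e', fun Y v p a f c hp h => he' Y v p a f c hp ?_⟩
    refine KleeneEval.S4 e e₁ (g 0 v) c _ _ ?_ (by simpa [List.ofFn_succ] using h)
    rw [← List.append_assoc]
    exact he₁ _ _ _ _ _ _ (by simp [hp]) (by simp) (he₀ Y v _ f)

/-- Primitive recursive functions have an index. -/
theorem Nat.Primrec'.exists_index {n : ℕ} {F : List.Vector ℕ n → ℕ} (hF : Nat.Primrec' F) :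
    ∃ e, ∀ (Y : ℕ → (ℕ → ℕ) → (ℕ → ℕ)) (v : List.Vector ℕ n) (a : List ℕ) (f : List (ℕ → ℕ)),
      KleeneEval E I Y e (v.toList ++ a) f (F v) := by
  induction hF with
  | zero => exact ⟨seqNum [2, 0], fun Y v a f => KleeneEval.S2 0 _ f⟩
  | succ =>
    refine ⟨seqNum [1], fun Y v a f => ?_⟩
    rw [← v.cons_head_tail, List.Vector.toList_cons]
    exact KleeneEval.S1 _ _ f
  | @get n i =>
    refine ⟨seqNum [6, 0, i, seqNum [3]], fun Y v a f => ?_⟩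
    have hi : (i : ℕ) < v.toList.length := by simp
    have := KleeneEval.S6_zero (E := E) (I := I) (Y := Y) (seqNum [3]) (v.get i) (v.get i)
      (v.toList.take i) (v.toList.drop (i + 1) ++ a) f (KleeneEval.S3 _ _ _)
    rw [List.length_take_of_le hi.le] at this
    convert this using 1
    rw [← List.cons_append, ← List.append_assoc]
    congr 1
    conv_lhs => rw [← List.take_append_drop i v.toList, List.drop_eq_getElem_cons hi]
    rfl
  | @comp m n F g _ _ ihF ihg =>
    obtain ⟨e, he⟩ := ihF
    obtain ⟨e', he'⟩ := exists_index_push_values E I m n g ihg e 0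
    refine ⟨e', fun Y v a f => ?_⟩
    have := he' Y v [] a f _ rfl (by
      simpa [List.Vector.toList_ofFn] using
        he Y (List.Vector.ofFn fun i => g i v) (v.toList ++ a) f)
    simpa using this
  | @prec n F G _ _ ihF ihG =>
    obtain ⟨e, he⟩ := ihF
    obtain ⟨e', he'⟩ := ihG
    refine ⟨seqNum [5, e, e'], fun Y v a f => ?_⟩
    obtain ⟨x, v, rfl⟩ : ∃ x v', v = x ::ᵥ v' := ⟨_, _, v.cons_head_tail.symm⟩
    simp only [List.Vector.head_cons, List.Vector.tail_cons, List.Vector.toList_cons,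
      List.cons_append]
    induction x with
    | zero => exact KleeneEval.S5_zero _ _ _ _ _ (he Y v a f)
    | succ x ih =>
      exact KleeneEval.S5_succ _ _ _ _ _ _ _ ih (by simpa using he' Y (x ::ᵥ _ ::ᵥ v) a f)

end Indices

section FewArguments

variable (E : (ℕ → ℕ) → ℕ) (I : ((ℕ → ℕ) → (ℕ → ℕ)) → (ℕ → ℕ))

theorem Primrec.exists_index₁ {F : ℕ → ℕ} (hF : Primrec F) :
    ∃ e, ∀ (Y : ℕ → (ℕ → ℕ) → (ℕ → ℕ)) (x : ℕ) (a : List ℕ) (f : List (ℕ → ℕ)),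
      KleeneEval E I Y e (x :: a) f (F x) := by
  obtain ⟨e, he⟩ := (Nat.Primrec'.prim_iff₁.2 hF).exists_index E I
  exact ⟨e, fun Y x a f => by simpa using he Y (x ::ᵥ .nil) a f⟩

theorem Primrec.exists_index₂ {F : ℕ × ℕ → ℕ} (hF : Primrec F) :
    ∃ e, ∀ (Y : ℕ → (ℕ → ℕ) → (ℕ → ℕ)) (x y : ℕ) (a : List ℕ) (f : List (ℕ → ℕ)),
      KleeneEval E I Y e (x :: y :: a) f (F (x, y)) := by
  have h : Primrec fun v : List.Vector ℕ 2 => F (v.head, v.tail.head) :=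
    hF.comp (Primrec.vector_head.pair (Primrec.vector_head.comp Primrec.vector_tail))
  obtain ⟨e, he⟩ := (Nat.Primrec'.prim_iff.2 h).exists_index E I
  exact ⟨e, fun Y x y a f => by simpa using he Y (x ::ᵥ y ::ᵥ .nil) a f⟩

theorem Primrec.exists_index₃ {F : ℕ × ℕ × ℕ → ℕ} (hF : Primrec F) :
    ∃ e, ∀ (Y : ℕ → (ℕ → ℕ) → (ℕ → ℕ)) (x y z : ℕ) (a : List ℕ) (f : List (ℕ → ℕ)),
      KleeneEval E I Y e (x :: y :: z :: a) f (F (x, y, z)) := by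
  have h : Primrec fun v : List.Vector ℕ 3 => F (v.head, v.tail.head, v.tail.tail.head) :=
    hF.comp (Primrec.vector_head.pair ((Primrec.vector_head.comp Primrec.vector_tail).pair
      (Primrec.vector_head.comp (Primrec.vector_tail.comp Primrec.vector_tail))))
  obtain ⟨e, he⟩ := (Nat.Primrec'.prim_iff.2 h).exists_index E I
  exact ⟨e, fun Y x y z a f => by simpa using he Y (x ::ᵥ y ::ᵥ z ::ᵥ .nil) a f⟩

theorem Primrec.exists_index₄ {F : ℕ × ℕ × ℕ × ℕ → ℕ} (hF : Primrec F) :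
    ∃ e, ∀ (Y : ℕ → (ℕ → ℕ) → (ℕ → ℕ)) (x y z w : ℕ) (a : List ℕ) (f : List (ℕ → ℕ)),
      KleeneEval E I Y e (x :: y :: z :: w :: a) f (F (x, y, z, w)) := by
  have h : Primrec fun v : List.Vector ℕ 4 =>
      F (v.head, v.tail.head, v.tail.tail.head, v.tail.tail.tail.head) :=
    hF.comp (Primrec.vector_head.pair ((Primrec.vector_head.comp Primrec.vector_tail).pair
      ((Primrec.vector_head.comp (Primrec.vector_tail.comp Primrec.vector_tail)).pair
        (Primrec.vector_head.comp (Primrec.vector_tail.comp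
          (Primrec.vector_tail.comp Primrec.vector_tail))))))
  obtain ⟨e, he⟩ := (Nat.Primrec'.prim_iff.2 h).exists_index E I
  exact ⟨e, fun Y x y z w a f => by simpa using he Y (x ::ᵥ y ::ᵥ z ::ᵥ w ::ᵥ .nil) a f⟩

end FewArguments

/-! ### Uniform computability and its closure properties -/

/-- The functions `F c : α → β` are computable in `∃²`, `IND`, `Y c` and `fs c`, uniformly in the
parameter `c`. Further numerical arguments are ignored. -/
def UniformlyComputable {γ α β : Type*} [Primcodable α] [Primcodable β]
    (Y : γ → ℕ → (ℕ → ℕ) → (ℕ → ℕ)) (fs : γ → List (ℕ → ℕ)) (F : γ → α → β) : Prop :=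
  ∃ e, ∀ (c : γ) (x : α) (a : List ℕ),
    KleeneEval existsTwo IND (Y c) e (encode x :: a) (fs c) (encode (F c x))

open Classical in
/-- The predicates `P c` on `α` are decidable in `∃²`, `IND`, `Y c` and `fs c`, uniformly in the
parameter `c`. -/
def UniformlyDecidable {γ α : Type*} [Primcodable α]
    (Y : γ → ℕ → (ℕ → ℕ) → (ℕ → ℕ)) (fs : γ → List (ℕ → ℕ)) (P : γ → α → Prop) : Prop :=
  UniformlyComputable Y fs fun c x => decide (P c x)

section Closure

variable {γ α β σ : Type*} [Primcodable α] [Primcodable β] [Primcodable σ]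
  {Y : γ → ℕ → (ℕ → ℕ) → (ℕ → ℕ)} {fs : γ → List (ℕ → ℕ)}

/-- A second number in front of the argument is skipped. -/
theorem KleeneEval.skip_one {E : (ℕ → ℕ) → ℕ} {I : ((ℕ → ℕ) → (ℕ → ℕ)) → (ℕ → ℕ)}
    {Y : ℕ → (ℕ → ℕ) → (ℕ → ℕ)} {e x y c : ℕ} {a : List ℕ} {f : List (ℕ → ℕ)}
    (h : KleeneEval E I Y e (x :: y :: a) f c) :
    KleeneEval E I Y (seqNum [6, 0, 1, e]) (y :: x :: a) f c :=
  KleeneEval.S6_zero e x c [y] a f h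

namespace UniformlyComputable

theorem of_primrec {F : α → β} (hF : Primrec F) :
    UniformlyComputable Y fs fun _ => F := by
  -- On codes, `Primrec` speaks of a value in `Option β`, whose encoding is shifted by one; the
  -- predecessor undoes the shift.
  obtain ⟨e, he⟩ := (Primrec.pred.comp (Primrec.nat_iff.2 hF)).exists_index₁ existsTwo IND
  exact ⟨e, fun c x a => by simpa using he (Y c) (encode x) a (fs c)⟩

theorem comp {F : γ → β → σ} {G : γ → α → β} (hF : UniformlyComputable Y fs F)
    (hG : UniformlyComputable Y fs G) : UniformlyComputable Y fs fun c x => F c (G c x) := by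
  obtain ⟨e, he⟩ := hF
  obtain ⟨e', he'⟩ := hG
  exact ⟨seqNum [4, e, e'], fun c x a => .S4 _ _ _ _ _ _ (he' c x a) (he c _ _)⟩

theorem pair {F : γ → α → β} {G : γ → α → σ} (hF : UniformlyComputable Y fs F)
    (hG : UniformlyComputable Y fs G) : UniformlyComputable Y fs fun c x => (F c x, G c x) := by
  obtain ⟨e, he⟩ := hF
  obtain ⟨e', he'⟩ := hG
  obtain ⟨p, hp⟩ := (Primrec₂.natPair.comp .snd .fst).exists_index₂ existsTwo IND
  exact ⟨seqNum [4, seqNum [4, p, seqNum [6, 0, 1, e']], e], fun c x a =>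
    .S4 _ _ _ _ _ _ (he c x a) (.S4 _ _ _ _ _ _ (he' c x _).skip_one (hp (Y c) _ _ _ _))⟩

theorem comp_primrec {F : γ → β → σ} {g : α → β} (hF : UniformlyComputable Y fs F)
    (hg : Primrec g) : UniformlyComputable Y fs fun c x => F c (g x) :=
  hF.comp (of_primrec hg)

theorem nat_rec {F : γ → α → ℕ} {G : γ → α × ℕ × ℕ → ℕ} (hF : UniformlyComputable Y fs F)
    (hG : UniformlyComputable Y fs G) : UniformlyComputable Y fs fun c (z : α × ℕ) =>
      (z.2.rec (F c z.1) fun n r => G c (z.1, n, r) : ℕ) := by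
  obtain ⟨e, he⟩ := hF
  obtain ⟨e', he'⟩ := hG
  obtain ⟨l, hl⟩ := (Primrec.fst.comp Primrec.unpair).exists_index₁ existsTwo IND
  obtain ⟨r, hr⟩ := (Primrec.snd.comp Primrec.unpair).exists_index₁ existsTwo IND
  have hq : Primrec fun v : ℕ × ℕ × ℕ => Nat.pair v.2.2 (Nat.pair v.1 v.2.1) :=
    Primrec₂.natPair.comp (Primrec.snd.comp .snd)
      (Primrec₂.natPair.comp .fst (Primrec.fst.comp .snd))
  obtain ⟨q, hq⟩ := hq.exists_index₃ existsTwo IND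
  refine ⟨seqNum [4, seqNum [4, seqNum [5, e, seqNum [4, e', q]], seqNum [6, 0, 1, r]], l],
    fun c z a => ?_⟩
  obtain ⟨x, n⟩ := z
  refine .S4 _ _ _ _ _ _ (hl _ _ _ _) (.S4 _ _ _ _ _ _ (hr _ _ _ _).skip_one ?_)
  simp only [Encodable.encode_prod_val, Nat.unpair_pair, Encodable.encode_nat]
  generalize Nat.pair (encode x) n :: a = b
  induction n with
  | zero => exact .S5_zero _ _ _ _ _ (he c x b)
  | succ n ih =>
    exact .S5_succ _ _ _ _ _ _ _ ih (.S4 _ _ _ _ _ _ (hq _ _ _ _ _ _) (he' c (x, n, _) _))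

/-- Application of a function argument. -/
theorem oracle {φ : γ → ℕ → ℕ} (hfs : ∀ c, ∃ f, fs c = φ c :: f) :
    UniformlyComputable Y fs φ := by
  refine ⟨seqNum [7], fun c x a => ?_⟩
  obtain ⟨f, hf⟩ := hfs c
  rw [hf]
  exact .S7 _ _ _ _

/-- Application of the sequence of functionals. -/
theorem apply_functional {H : γ → α × ℕ → ℕ} {N M : γ → α → ℕ} (hH : UniformlyComputable Y fs H)
    (hN : UniformlyComputable Y fs N) (hM : UniformlyComputable Y fs M) :
    UniformlyComputable Y fs fun c x => Y c (N c x) (fun t => H c (x, t)) (M c x) := by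
  obtain ⟨e, he⟩ := hH
  obtain ⟨n, hn⟩ := hN
  obtain ⟨m, hm⟩ := hM
  have hq : Primrec fun v : ℕ × ℕ × ℕ × ℕ => Nat.pair v.2.2.2 v.1 :=
    Primrec₂.natPair.comp (Primrec.snd.comp (Primrec.snd.comp .snd)) .fst
  obtain ⟨q, hq⟩ := hq.exists_index₄ existsTwo IND
  exact ⟨seqNum [4, seqNum [4, seqNum [8, 1, seqNum [4, e, q]], seqNum [6, 0, 1, n]], m],
    fun c x a => .S4 _ _ _ _ _ _ (hm c x a) <| .S4 _ _ _ _ _ _ (hn c x _).skip_one <|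
      .S8_Y _ _ _ _ _ _ fun t => .S4 _ _ _ _ _ _ (hq _ _ _ _ _ _ _) (he c (x, t) _)⟩

/-- Application of `IND`. -/
theorem apply_IND {Y : γ → ℕ → (ℕ → ℕ) → (ℕ → ℕ)} {G : γ → (ℕ → ℕ) → ℕ → ℕ}
    (hG : UniformlyComputable (fun c : γ × (ℕ → ℕ) => Y c.1) (fun c => c.2 :: fs c.1)
      fun c => G c.1 c.2) :
    UniformlyComputable Y fs fun c => IND (G c) := by
  obtain ⟨e, he⟩ := hG
  exact ⟨seqNum [8, 2, e], fun c m a => .S8_I _ _ _ _ _ fun φ t => he (c, φ) t _⟩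

end UniformlyComputable

namespace UniformlyDecidable

theorem of_bool {P : γ → α → Prop} {F : γ → α → Bool} (hF : UniformlyComputable Y fs F)
    (h : ∀ c x, F c x = true ↔ P c x) : UniformlyDecidable Y fs P := by
  classical
  rwa [UniformlyDecidable, show (fun c x => decide (P c x)) = F from
    funext₂ fun c x => by rw [Bool.eq_iff_iff, decide_eq_true_iff, h]]

theorem of_primrecPred {P : α → Prop} (hP : PrimrecPred P) :
    UniformlyDecidable Y fs fun _ => P := by
  obtain ⟨_, h⟩ := hP
  exact of_bool (.of_primrec h) fun c x => decide_eq_true_iff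

theorem comp {P : γ → β → Prop} {G : γ → α → β} (hP : UniformlyDecidable Y fs P)
    (hG : UniformlyComputable Y fs G) : UniformlyDecidable Y fs fun c x => P c (G c x) :=
  UniformlyComputable.comp hP hG

theorem comp_primrec {P : γ → β → Prop} {g : α → β} (hP : UniformlyDecidable Y fs P)
    (hg : Primrec g) : UniformlyDecidable Y fs fun c x => P c (g x) :=
  hP.comp (.of_primrec hg)

theorem not {P : γ → α → Prop} (hP : UniformlyDecidable Y fs P) :
    UniformlyDecidable Y fs fun c x => ¬ P c x := by
  exact of_bool ((UniformlyComputable.of_primrec Primrec.not).comp hP) fun c x => by simp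

theorem and {P Q : γ → α → Prop} (hP : UniformlyDecidable Y fs P)
    (hQ : UniformlyDecidable Y fs Q) : UniformlyDecidable Y fs fun c x => P c x ∧ Q c x := by
  exact of_bool ((UniformlyComputable.of_primrec (Primrec.and.comp .fst .snd)).comp
    (UniformlyComputable.pair hP hQ)) fun c x => by simp

theorem or {P Q : γ → α → Prop} (hP : UniformlyDecidable Y fs P)
    (hQ : UniformlyDecidable Y fs Q) : UniformlyDecidable Y fs fun c x => P c x ∨ Q c x := by
  exact of_bool ((UniformlyComputable.of_primrec (Primrec.or.comp .fst .snd)).comp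
    (UniformlyComputable.pair hP hQ)) fun c x => by simp

theorem imp {P Q : γ → α → Prop} (hP : UniformlyDecidable Y fs P)
    (hQ : UniformlyDecidable Y fs Q) : UniformlyDecidable Y fs fun c x => P c x → Q c x := by
  simpa only [imp_iff_not_or] using hP.not.or hQ

theorem of_iff {P Q : γ → α → Prop} (hP : UniformlyDecidable Y fs P) (h : ∀ c x, P c x ↔ Q c x) :
    UniformlyDecidable Y fs Q := by
  rwa [show Q = P from funext₂ fun c x => propext (h c x).symm]

/-- Application of `∃²`. -/
theorem exists_nat {P : γ → α × ℕ → Prop} (hP : UniformlyDecidable Y fs P) :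
    UniformlyDecidable Y fs fun c x => ∃ n, P c (x, n) := by
  classical
  -- `∃²` looks for a zero, and `false` has code `0`: the negation vanishes exactly where `P` holds.
  -- The answer `0` for success is then flipped by `1 - ·`.
  obtain ⟨e, he⟩ := hP.not
  obtain ⟨q, hq⟩ := (Primrec₂.natPair.comp .snd .fst).exists_index₂ existsTwo IND
  obtain ⟨r, hr⟩ := (Primrec.nat_sub.comp (.const 1) .id).exists_index₁ existsTwo IND
  refine ⟨seqNum [4, r, seqNum [8, 0, seqNum [4, e, q]]], fun c x a => ?_⟩
  have h := KleeneEval.S4 _ _ _ _ _ _ (KleeneEval.S8_E (E := existsTwo) (I := IND) (Y := Y c)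
    (seqNum [4, e, q]) _ (encode x :: a) (fs c) fun t =>
      .S4 _ _ _ _ _ _ (hq _ _ _ _ _) (he c (x, t) _)) (hr _ _ _ _)
  convert h using 1
  by_cases hx : ∃ n, P c (x, n)
  · obtain ⟨n, hn⟩ := hx
    have : ∃ n, encode (!decide (P c (x, n))) = 0 := ⟨n, by simp [hn]⟩
    simp [existsTwo, this, show ∃ n, P c (x, n) from ⟨n, hn⟩]
  · push Not at hx
    simp [existsTwo, hx]

theorem forall_nat {P : γ → α × ℕ → Prop} (hP : UniformlyDecidable Y fs P) :
    UniformlyDecidable Y fs fun c x => ∀ n, P c (x, n) :=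
  hP.not.exists_nat.not.of_iff fun c x => by simp

end UniformlyDecidable

namespace UniformlyComputable

theorem ite {P : γ → α → Prop} [∀ c x, Decidable (P c x)] {F G : γ → α → ℕ}
    (hP : UniformlyDecidable Y fs P) (hF : UniformlyComputable Y fs F)
    (hG : UniformlyComputable Y fs G) :
    UniformlyComputable Y fs fun c x => if P c x then F c x else G c x := by
  have := (of_primrec (Primrec.cond (.fst) (Primrec.fst.comp .snd)
    (Primrec.snd.comp .snd))).comp (UniformlyComputable.pair hP (hF.pair hG))
  simp only [Bool.cond_decide] at this
  convert this

/-- Unbounded search, by applying a suitable index to itself. -/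
theorem nat_sInf_of_nonempty {P : γ → α × ℕ → Prop} {k : ℕ} (hfs : ∀ c, (fs c).length = k)
    (hP : UniformlyDecidable Y fs P) (hne : ∀ c x, ∃ n, P c (x, n)) :
    UniformlyComputable Y fs fun c x => sInf {n | P c (x, n)} := by
  obtain ⟨e, he⟩ := hP
  obtain ⟨p, hp⟩ := (Primrec.fst.comp (Primrec.snd (α := ℕ) (β := ℕ × ℕ))).exists_index₃
    existsTwo IND
  obtain ⟨q, hq⟩ := (Primrec₂.natPair.comp (Primrec.snd.comp .snd)
    (Primrec.fst.comp (Primrec.snd (α := ℕ) (β := ℕ × ℕ)))).exists_index₃ existsTwo IND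
  obtain ⟨x₁, hx₁⟩ := (Primrec.snd.comp (Primrec.snd (α := ℕ) (β := ℕ × ℕ))).exists_index₃
    existsTwo IND
  obtain ⟨n₁, hn₁⟩ := (Primrec.succ.comp (Primrec.fst.comp (Primrec.snd.comp
    (Primrec.snd (α := ℕ) (β := ℕ × ℕ × ℕ))))).exists_index₄ existsTwo IND
  obtain ⟨b₁, hb₁⟩ := (Primrec.fst.comp (Primrec.snd.comp
    (Primrec.snd (α := ℕ) (β := ℕ × ℕ × ℕ)))).exists_index₄ existsTwo IND
  obtain ⟨b₀, hb₀⟩ := (Primrec.id (α := ℕ)).exists_index₁ existsTwo IND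
  let s := seqNum [9, 3, k]
  -- From `(g, n, x)`, the index `r` continues the search by calling `{g}(g, n + 1, x)`, while `p`
  -- stops it by returning `n`. Here `w` selects an index, not a value: S4 evaluates eagerly, so S9
  -- may only run the branch that is needed.
  let r := seqNum [4, seqNum [4, seqNum [4, seqNum [4, s, b₀], b₁], n₁], x₁]
  obtain ⟨w, hw⟩ := (Primrec.ite (Primrec.eq.comp Primrec.id (Primrec.const 0))
    (Primrec.const r) (Primrec.const p)).exists_index₁ existsTwo IND
  let g := seqNum [4, s, seqNum [4, w, seqNum [4, e, q]]]
  have hs : ∀ c j y n x v a, KleeneEval existsTwo IND (Y c) j [y, n, x] (fs c) v →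
      KleeneEval existsTwo IND (Y c) s (j :: y :: n :: x :: a) (fs c) v := by
    intro c j y n x v a h
    have := KleeneEval.S9 j v [y, n, x] a (fs c) [] h
    simpa [hfs] using this
  -- The self-application terminates by induction on the distance `d` to the least solution.
  have hg : ∀ c x d n, n + d = sInf {n | P c (x, n)} → ∀ a,
      KleeneEval existsTwo IND (Y c) g (g :: n :: encode x :: a) (fs c)
        (sInf {n | P c (x, n)}) := by
    intro c x d
    induction d with
    | zero =>
      intro n hn a
      have hn' : P c (x, n) := by
        have : sInf {n | P c (x, n)} ∈ {n | P c (x, n)} := Nat.sInf_mem (hne c x)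
        rwa [← hn] at this
      refine .S4 _ _ p _ _ _ (.S4 _ _ _ _ _ _ (.S4 _ _ _ _ _ _ (hq _ _ _ _ _ _) (he c (x, n) _)) ?_)
        (hs _ _ _ _ _ _ _ ?_)
      · simpa [hn'] using hw (Y c) 1 _ _
      · simpa [← hn] using hp (Y c) g n (encode x) [] (fs c)
    | succ d ih =>
      intro n hn a
      have hn' : ¬ P c (x, n) := fun h => by
        have : sInf {n | P c (x, n)} ≤ n := Nat.sInf_le h
        omega
      refine .S4 _ _ r _ _ _ (.S4 _ _ _ _ _ _ (.S4 _ _ _ _ _ _ (hq _ _ _ _ _ _) (he c (x, n) _)) ?_)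
        (hs _ _ _ _ _ _ _ ?_)
      · simpa [hn'] using hw (Y c) 0 _ _
      · refine .S4 _ _ _ _ _ _ (hx₁ _ _ _ _ _ _) (.S4 _ _ _ _ _ _ (hn₁ _ _ _ _ _ _ _)
          (.S4 _ _ _ _ _ _ (hb₁ _ _ _ _ _ _ _) (.S4 _ _ _ _ _ _ (hb₀ _ _ _ _)
            (hs _ _ _ _ _ _ _ (ih (n + 1) (by omega) _)))))
  exact ⟨seqNum [4, seqNum [4, g, seqNum [2, g]], seqNum [2, 0]], fun c x a =>
    .S4 _ _ _ _ _ _ (.S2 _ _ _) (.S4 _ _ _ _ _ _ (.S2 _ _ _) (hg c x _ 0 (zero_add _) _))⟩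

/-- Unbounded search, with the value `0` if it is not successful. -/
theorem nat_sInf {P : γ → α × ℕ → Prop} {k : ℕ} (hfs : ∀ c, (fs c).length = k)
    (hP : UniformlyDecidable Y fs P) :
    UniformlyComputable Y fs fun c x => sInf {n | P c (x, n)} := by
  -- A search without solution is made to stop at once by also accepting any `n` when `∃²` finds
  -- that there is none; this agrees with `sInf ∅ = 0`.
  have := nat_sInf_of_nonempty hfs (hP.or (hP.exists_nat.not.comp_primrec Primrec.fst))
    fun c x => by
    by_cases h : ∃ n, P c (x, n)
    · exact h.imp fun n hn => .inl hn
    · exact ⟨0, .inr h⟩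
  convert this using 3 with c x
  by_cases h : ∃ n, P c (x, n)
  · simp [h]
  · push Not at h
    simp [h]

end UniformlyComputable

end Closure

/-! ### Coded rationals and their primitive recursive comparison -/

section Rationals

/-- The numerators of the positive and the negative part of a coded rational. -/
def codePosPart (c : ℕ) : ℕ := if c.unpair.1 % 2 = 0 then c.unpair.1 / 2 else 0

def codeNegPart (c : ℕ) : ℕ := if c.unpair.1 % 2 = 0 then 0 else (c.unpair.1 + 1) / 2

theorem ratOfCode_eq (c : ℕ) :
    ratOfCode c = ((codePosPart c : ℚ) - codeNegPart c) / (c.unpair.2 + 1) := by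
  unfold ratOfCode codePosPart codeNegPart
  split_ifs <;> simp

/-- Denominators are cleared and negative terms moved across, so that the comparison takes place in
the natural numbers. -/
theorem one_div_succ_lt_ratOfCode_iff (c j : ℕ) : 1 / ((j : ℚ) + 1) < ratOfCode c ↔
    codeNegPart c * (j + 1) + (c.unpair.2 + 1) < codePosPart c * (j + 1) := by
  rw [ratOfCode_eq, div_lt_div_iff₀ (by positivity) (by positivity), ← Nat.cast_lt (α := ℚ)]
  push_cast
  constructor <;> intro h <;> linarith

theorem ratOfCode_sub_lt_iff (c d k : ℕ) : ratOfCode c - ratOfCode d < 1 / 2 ^ k ↔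
    2 ^ k * (codePosPart c * (d.unpair.2 + 1) + codeNegPart d * (c.unpair.2 + 1)) <
      2 ^ k * (codeNegPart c * (d.unpair.2 + 1) + codePosPart d * (c.unpair.2 + 1)) +
        (c.unpair.2 + 1) * (d.unpair.2 + 1) := by
  rw [ratOfCode_eq, ratOfCode_eq, div_sub_div _ _ (by positivity) (by positivity),
    div_lt_div_iff₀ (by positivity) (by positivity), ← Nat.cast_lt (α := ℚ)]
  push_cast
  constructor <;> intro h <;> linarith

theorem primrec_codePosPart : Primrec codePosPart :=
  Primrec.ite (Primrec.eq.comp (Primrec.nat_mod.comp (Primrec.fst.comp Primrec.unpair) (.const 2))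
    (.const 0)) (Primrec.nat_div.comp (Primrec.fst.comp Primrec.unpair) (.const 2)) (.const 0)

theorem primrec_codeNegPart : Primrec codeNegPart :=
  Primrec.ite (Primrec.eq.comp (Primrec.nat_mod.comp (Primrec.fst.comp Primrec.unpair) (.const 2))
    (.const 0)) (.const 0) (Primrec.nat_div.comp
      (Primrec.succ.comp (Primrec.fst.comp Primrec.unpair)) (.const 2))

theorem primrec_two_pow : Primrec fun k : ℕ => 2 ^ k :=
  (Primrec.nat_iff.2 Nat.Primrec.pow).comp (Primrec₂.natPair.comp (.const 2) .id) |>.of_eq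
    fun k => by simp

theorem primrec_den : Primrec fun c : ℕ => c.unpair.2 + 1 :=
  Primrec.succ.comp (Primrec.snd.comp Primrec.unpair)

theorem primrecPred_one_div_succ_lt :
    PrimrecPred fun v : ℕ × ℕ => 1 / ((v.2 : ℚ) + 1) < ratOfCode v.1 := by
  have : PrimrecPred fun v : ℕ × ℕ => codeNegPart v.1 * (v.2 + 1) + (v.1.unpair.2 + 1) <
      codePosPart v.1 * (v.2 + 1) :=
    Primrec.nat_lt.comp
      (Primrec.nat_add.comp (Primrec.nat_mul.comp (primrec_codeNegPart.comp .fst)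
        (Primrec.succ.comp .snd)) (primrec_den.comp .fst))
      (Primrec.nat_mul.comp (primrec_codePosPart.comp .fst) (Primrec.succ.comp .snd))
  exact this.of_eq fun v => (one_div_succ_lt_ratOfCode_iff v.1 v.2).symm

theorem primrecPred_ratOfCode_sub_lt :
    PrimrecPred fun v : ℕ × ℕ × ℕ => ratOfCode v.1 - ratOfCode v.2.1 < 1 / 2 ^ v.2.2 := by
  have hc : Primrec fun v : ℕ × ℕ × ℕ => v.1 := .fst
  have hd : Primrec fun v : ℕ × ℕ × ℕ => v.2.1 := Primrec.fst.comp .snd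
  have hk := primrec_two_pow.comp
    (Primrec.snd.comp .snd : Primrec fun v : ℕ × ℕ × ℕ => v.2.2)
  refine PrimrecPred.of_eq (Primrec.nat_lt.comp
    (Primrec.nat_mul.comp hk (Primrec.nat_add.comp
      (Primrec.nat_mul.comp (primrec_codePosPart.comp hc) (primrec_den.comp hd))
      (Primrec.nat_mul.comp (primrec_codeNegPart.comp hd) (primrec_den.comp hc))))
    (Primrec.nat_add.comp (Primrec.nat_mul.comp hk (Primrec.nat_add.comp
      (Primrec.nat_mul.comp (primrec_codeNegPart.comp hc) (primrec_den.comp hd))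
      (Primrec.nat_mul.comp (primrec_codePosPart.comp hd) (primrec_den.comp hc))))
      (Primrec.nat_mul.comp (primrec_den.comp hc) (primrec_den.comp hd))))
    fun v => (ratOfCode_sub_lt_iff v.1 v.2.1 v.2.2).symm

theorem primrecPred_abs_ratOfCode_sub_lt :
    PrimrecPred fun v : ℕ × ℕ × ℕ => |ratOfCode v.1 - ratOfCode v.2.1| < 1 / 2 ^ v.2.2 := by
  have := primrecPred_ratOfCode_sub_lt.and (primrecPred_ratOfCode_sub_lt.comp
    ((Primrec.fst.comp .snd).pair (Primrec.fst.pair (Primrec.snd.comp .snd))))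
  refine this.of_eq fun v => ?_
  rw [abs_sub_lt_iff]

theorem ratOfCode_surjective : Function.Surjective ratOfCode := by
  intro q
  have hq : ((q.den - 1 : ℕ) : ℚ) + 1 = q.den := by
    have := q.den_pos
    exact_mod_cast Nat.sub_add_cancel this
  obtain ⟨n, hn | hn⟩ := q.num.eq_nat_or_neg
  · refine ⟨Nat.pair (2 * n) (q.den - 1), ?_⟩
    simp only [ratOfCode, Nat.unpair_pair, Nat.mul_mod_right, if_true, hq]
    rw [Nat.mul_div_cancel_left _ two_pos]
    conv_rhs => rw [← q.num_div_den, hn]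
    simp
  · rcases n with - | n
    · exact ⟨0, by simp at hn; simp [ratOfCode, hn]⟩
    refine ⟨Nat.pair (2 * n + 1) (q.den - 1), ?_⟩
    simp only [ratOfCode, Nat.unpair_pair, hq]
    rw [if_neg (by omega), show (2 * n + 1 + 1) / 2 = n + 1 by omega]
    conv_rhs => rw [← q.num_div_den, hn]
    push_cast
    ring

end Rationals

/-! ### Positivity of coded reals is arithmetical -/

section Positivity

/-- The index `k` is the minimum of `n` and the first failure of fast convergence. This describes
the hat function without recursion, by conditions that determine `k`. -/
theorem exists_hatSeq_eq (q : ℕ → ℚ) (n : ℕ) : ∃ k ≤ n,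
    (∀ i < k, |q i - q (i + 1)| < 1 / 2 ^ (i + 1)) ∧
      (k = n ∨ ¬ |q k - q (k + 1)| < 1 / 2 ^ (k + 1)) ∧ hatSeq q n = q k := by
  induction n with
  | zero => exact ⟨0, le_rfl, by simp, .inl rfl, rfl⟩
  | succ n ih =>
    by_cases h : ∀ k ≤ n, |q k - q (k + 1)| < 1 / 2 ^ (k + 1)
    · exact ⟨n + 1, le_rfl, fun i hi => h i (Nat.le_of_lt_succ hi), .inl rfl, if_pos h⟩
    · obtain ⟨k, hk, hlt, hor, heq⟩ := ih
      refine ⟨k, hk.trans n.le_succ, hlt, .inr fun hgood => ?_, (if_neg h).trans heq⟩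
      rcases hor with rfl | hbad
      · exact h fun i hi => hi.lt_or_eq.elim (hlt i) fun e => e ▸ hgood
      · exact hbad hgood

/-- Positivity of a coded real, as an arithmetical property of the code. -/
theorem realOfCode_pos_iff (g : ℕ → ℕ) : 0 < realOfCode g ↔
    ∃ j, ∀ n, j ≤ n → ∃ k, k ≤ n ∧
      (∀ i, i < k → |ratOfCode (g i) - ratOfCode (g (i + 1))| < 1 / 2 ^ (i + 1)) ∧
      (k = n ∨ ¬ |ratOfCode (g k) - ratOfCode (g (k + 1))| < 1 / 2 ^ (k + 1)) ∧
      1 / ((j : ℚ) + 1) < ratOfCode (g k) := by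
  have key : ∀ j n : ℕ, (∃ k, k ≤ n ∧
      (∀ i, i < k → |ratOfCode (g i) - ratOfCode (g (i + 1))| < 1 / 2 ^ (i + 1)) ∧
      (k = n ∨ ¬ |ratOfCode (g k) - ratOfCode (g (k + 1))| < 1 / 2 ^ (k + 1)) ∧
      1 / ((j : ℚ) + 1) < ratOfCode (g k)) ↔
      1 / ((j : ℝ) + 1) < (hatSeq (fun k => ratOfCode (g k)) n : ℚ) := by
    intro j n
    rw [show 1 / ((j : ℝ) + 1) = ((1 / ((j : ℚ) + 1) : ℚ) : ℝ) by push_cast; rfl, Rat.cast_lt]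
    obtain ⟨k, hk, hlt, hor, heq⟩ := exists_hatSeq_eq (fun k => ratOfCode (g k)) n
    rw [heq]
    refine ⟨?_, fun h => ⟨k, hk, hlt, hor, h⟩⟩
    rintro ⟨k', hk', hlt', hor', h⟩
    obtain rfl : k = k' := by
      rcases lt_trichotomy k k' with hkk | hkk | hkk
      · exact (hor.resolve_left (hkk.trans_le hk').ne (hlt' k hkk)).elim
      · exact hkk
      · exact (hor'.resolve_left (hkk.trans_le hk).ne (hlt k' hkk)).elim
    exact h
  simp only [key]
  have ht := tendsto_realOfCode g
  constructor
  · intro h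
    obtain ⟨a, ha₀, ha⟩ := exists_between h
    obtain ⟨N, hN⟩ := Filter.eventually_atTop.1 (ht.eventually (lt_mem_nhds ha))
    obtain ⟨m, hm⟩ := exists_nat_one_div_lt ha₀
    -- A single `j` serves both as the threshold for `n` and in the lower bound `1 / (j + 1)`, so it
    -- must exceed both `N` and `m`.
    refine ⟨max N m, fun n hn => lt_of_le_of_lt ?_ (hm.trans (hN n (le_of_max_le_left hn)))⟩
    exact Nat.one_div_le_one_div (le_max_right N m)
  · rintro ⟨j, hj⟩
    exact Nat.one_div_pos_of_nat.trans_le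
      (ge_of_tendsto ht (Filter.eventually_atTop.2 ⟨j, fun n hn => (hj n hn).le⟩))

theorem UniformlyDecidable.realOfCode_pos {γ α : Type*} [Primcodable α]
    {Y : γ → ℕ → (ℕ → ℕ) → (ℕ → ℕ)} {fs : γ → List (ℕ → ℕ)} {G : γ → α × ℕ → ℕ}
    (hG : UniformlyComputable Y fs G) :
    UniformlyDecidable Y fs fun c x => 0 < realOfCode fun m => G c (x, m) := by
  have hgood : UniformlyDecidable Y fs fun c (z : α × ℕ) =>
      |ratOfCode (G c z) - ratOfCode (G c (z.1, z.2 + 1))| < 1 / 2 ^ (z.2 + 1) := by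
    have hs : Primrec fun z : α × ℕ => z.2 + 1 := Primrec.succ.comp .snd
    have h : UniformlyComputable Y fs fun c (z : α × ℕ) => (G c z, G c (z.1, z.2 + 1), z.2 + 1) :=
      hG.pair ((hG.comp_primrec (Primrec.fst.pair hs)).pair (.of_primrec hs))
    have := (UniformlyDecidable.of_primrecPred primrecPred_abs_ratOfCode_sub_lt).comp h
    exact this
  -- the variables are `(((x, j), n), k)`, followed by `i`
  have h₁ : UniformlyDecidable Y fs fun c (z : ((α × ℕ) × ℕ) × ℕ) => z.2 ≤ z.1.2 :=
    .of_primrecPred (Primrec.nat_le.comp .snd (Primrec.snd.comp .fst))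
  have h₂ : UniformlyDecidable Y fs fun c (z : ((α × ℕ) × ℕ) × ℕ) => ∀ i, i < z.2 →
      |ratOfCode (G c (z.1.1.1, i)) - ratOfCode (G c (z.1.1.1, i + 1))| < 1 / 2 ^ (i + 1) :=
    UniformlyDecidable.forall_nat (P := fun c (w : (((α × ℕ) × ℕ) × ℕ) × ℕ) => w.2 < w.1.2 →
      |ratOfCode (G c (w.1.1.1.1, w.2)) - ratOfCode (G c (w.1.1.1.1, w.2 + 1))| <
        1 / 2 ^ (w.2 + 1))
      (.imp (.of_primrecPred (Primrec.nat_lt.comp .snd (Primrec.snd.comp .fst)))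
        (hgood.comp_primrec (.pair (Primrec.fst.comp (Primrec.fst.comp
          (Primrec.fst.comp .fst))) .snd)))
  have hz : Primrec fun z : ((α × ℕ) × ℕ) × ℕ => (z.1.1.1, z.2) :=
    .pair (Primrec.fst.comp (Primrec.fst.comp .fst)) .snd
  have h₃ : UniformlyDecidable Y fs fun c (z : ((α × ℕ) × ℕ) × ℕ) => z.2 = z.1.2 ∨
      ¬ |ratOfCode (G c (z.1.1.1, z.2)) - ratOfCode (G c (z.1.1.1, z.2 + 1))| < 1 / 2 ^ (z.2 + 1) :=
    .or (.of_primrecPred (Primrec.eq.comp .snd (Primrec.snd.comp .fst)))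
      (hgood.comp_primrec hz).not
  have h₄ : UniformlyDecidable Y fs fun c (z : ((α × ℕ) × ℕ) × ℕ) =>
      1 / ((z.1.1.2 : ℚ) + 1) < ratOfCode (G c (z.1.1.1, z.2)) := by
    have h : UniformlyComputable Y fs fun c (z : ((α × ℕ) × ℕ) × ℕ) =>
        (G c (z.1.1.1, z.2), z.1.1.2) :=
      (hG.comp_primrec hz).pair (.of_primrec (Primrec.snd.comp (Primrec.fst.comp .fst)))
    have := (UniformlyDecidable.of_primrecPred primrecPred_one_div_succ_lt).comp h
    exact this
  have h₅ : UniformlyDecidable Y fs fun c (z : (α × ℕ) × ℕ) => z.1.2 ≤ z.2 :=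
    .of_primrecPred (Primrec.nat_le.comp (Primrec.snd.comp .fst) .snd)
  have h := (h₅.imp (h₁.and (h₂.and (h₃.and h₄))).exists_nat).forall_nat.exists_nat
  refine h.of_iff fun c x => ?_
  rw [realOfCode_pos_iff]

end Positivity

/-! ### The choice of balls and its computability -/

section Search

/-- A number `s` is read as the closed ball with centre coded by `s.unpair.1` and with radius
`2 ^ (-s.unpair.2)`. Given such a ball `s`, this is the first ball in a smaller concentric ball that
`φ` does not exclude at `n`. -/
noncomputable def nextBall (φ : ℕ → ℕ) (n s : ℕ) : ℕ :=
  sInf {b | (s.unpair.2 < b.unpair.2 ∧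
    |ratOfCode s.unpair.1 - ratOfCode b.unpair.1| < 1 / 2 ^ (s.unpair.2 + 1)) ∧
      φ (Nat.pair b n) = 0}

/-- The iteration of `nextBall`. -/
noncomputable def ballSeq (φ : ℕ → ℕ) (n : ℕ) : ℕ :=
  n.rec 0 fun n s => nextBall φ n s

/-- The sequence of the centres of the balls `ballSeq φ`. -/
noncomputable def centreSeq (φ : ℕ → ℕ) (m : ℕ) : ℕ := (ballSeq φ (m + 1)).unpair.1

open Classical in
/-- The ball chosen at `n` is to be excluded at `n` if the limit of the centres is not in the set
represented by `Y n`. -/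
noncomputable def exclusion (Y : ℕ → (ℕ → ℕ) → (ℕ → ℕ)) (φ : ℕ → ℕ) (t : ℕ) : ℕ :=
  if t.unpair.1 = ballSeq φ (t.unpair.2 + 1) ∧ ¬ 0 < realOfCode (Y t.unpair.2 (centreSeq φ))
  then 1 else 0

variable {γ : Type*} {Y : γ → ℕ → (ℕ → ℕ) → (ℕ → ℕ)} {fs : γ → List (ℕ → ℕ)} {k : ℕ}
  {φ : γ → ℕ → ℕ}

theorem uniformlyComputable_ballSeq (hfs : ∀ c, (fs c).length = k)
    (hφ : UniformlyComputable Y fs φ) : UniformlyComputable Y fs fun c => ballSeq (φ c) := by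
  have hs : Primrec fun z : (ℕ × ℕ × ℕ) × ℕ => z.1.2.2.unpair :=
    Primrec.unpair.comp (Primrec.snd.comp (Primrec.snd.comp .fst))
  have hb : Primrec fun z : (ℕ × ℕ × ℕ) × ℕ => z.2.unpair := Primrec.unpair.comp .snd
  have h : UniformlyDecidable Y fs fun c (z : (ℕ × ℕ × ℕ) × ℕ) =>
      (z.1.2.2.unpair.2 < z.2.unpair.2 ∧ |ratOfCode z.1.2.2.unpair.1 - ratOfCode z.2.unpair.1| <
        1 / 2 ^ (z.1.2.2.unpair.2 + 1)) ∧ φ c (Nat.pair z.2 z.1.2.1) = 0 := by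
    have h₁ := (Primrec.nat_lt.comp (Primrec.snd.comp hs) (Primrec.snd.comp hb)).and
      (primrecPred_abs_ratOfCode_sub_lt.comp (.pair (Primrec.fst.comp hs)
        (.pair (Primrec.fst.comp hb) (Primrec.succ.comp (Primrec.snd.comp hs)))))
    have h₂ : UniformlyComputable Y fs fun c (z : (ℕ × ℕ × ℕ) × ℕ) =>
        φ c (Nat.pair z.2 z.1.2.1) :=
      hφ.comp_primrec (Primrec₂.natPair.comp .snd (Primrec.fst.comp (Primrec.snd.comp .fst)))
    have h₃ := (UniformlyDecidable.of_primrecPred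
      (Primrec.eq.comp Primrec.id (Primrec.const 0))).comp h₂
    exact (UniformlyDecidable.of_primrecPred h₁).and h₃
  have hG : UniformlyComputable Y fs fun c (z : ℕ × ℕ × ℕ) => nextBall (φ c) z.2.1 z.2.2 :=
    .nat_sInf hfs h
  exact (UniformlyComputable.nat_rec (α := ℕ) (F := fun _ _ => 0) (.of_primrec (.const 0))
    hG).comp_primrec (Primrec.pair (.const 0) .id)

theorem uniformlyComputable_centreSeq (hfs : ∀ c, (fs c).length = k)
    (hφ : UniformlyComputable Y fs φ) : UniformlyComputable Y fs fun c => centreSeq (φ c) :=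
  (UniformlyComputable.of_primrec (Primrec.fst.comp Primrec.unpair)).comp
    ((uniformlyComputable_ballSeq hfs hφ).comp_primrec Primrec.succ)

/-- The search has a default value, so the centres are defined for every `φ`, even one excluding all
candidates; `Y n` can thus always be applied to them, and `∃²` decides positivity of the result. -/
theorem uniformlyComputable_exclusion (hfs : ∀ c, (fs c).length = k)
    (hφ : UniformlyComputable Y fs φ) :
    UniformlyComputable Y fs fun c => exclusion (Y c) (φ c) := by
  have hn : Primrec fun t : ℕ => t.unpair.2 := Primrec.snd.comp Primrec.unpair
  have h := UniformlyComputable.apply_functional (α := ℕ × ℕ)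
    ((uniformlyComputable_centreSeq hfs hφ).comp_primrec Primrec.snd)
    (.of_primrec (hn.comp .fst)) (.of_primrec .snd)
  have heq : UniformlyDecidable Y fs fun c (t : ℕ) => t.unpair.1 = ballSeq (φ c) (t.unpair.2 + 1) :=
    (UniformlyDecidable.of_primrecPred (Primrec.eq.comp Primrec.fst Primrec.snd)).comp
      (.pair (.of_primrec (Primrec.fst.comp Primrec.unpair))
        ((uniformlyComputable_ballSeq hfs hφ).comp_primrec (Primrec.succ.comp hn)))
  exact .ite (heq.and (UniformlyDecidable.realOfCode_pos h).not) (.of_primrec (.const 1))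
    (.of_primrec (.const 0))

theorem kleeneComputableIn_centreSeq_IND :
    KleeneComputableIn existsTwo IND fun Y => centreSeq (IND (exclusion Y)) := by
  have h : UniformlyComputable (fun Y : ℕ → (ℕ → ℕ) → (ℕ → ℕ) => Y) (fun _ => [])
      fun Y => IND (exclusion Y) :=
    .apply_IND (uniformlyComputable_exclusion (k := 1) (fun _ => rfl) (.oracle fun _ => ⟨_, rfl⟩))
  obtain ⟨e, he⟩ := uniformlyComputable_centreSeq (fun _ => rfl) h
  exact ⟨e, fun Y m => he Y m []⟩

end Search

/-! ### The limit lies in all the open dense sets -/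

section Correctness

/-- The inductive closure of a set operator is closed under it. -/
theorem subset_inductiveClosure (F : Set ℕ → Set ℕ) :
    F (inductiveClosure fun A => A ∪ F A) ⊆ inductiveClosure fun A => A ∪ F A := by
  set Γ : Set ℕ → Set ℕ := fun A => A ∪ F A
  have hΓ : ∀ A, A ⊆ Γ A := fun A => Set.subset_union_left
  obtain ⟨α, hα, h⟩ : ∃ α, inductiveStage Γ α = inductiveClosure Γ ∧
      inductiveStage Γ (Order.succ α) = inductiveClosure Γ :=
    ⟨_, rfl, csInf_mem (exists_inductiveStage_succ_eq Γ hΓ)⟩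
  -- The stages up to `α` have the closure as their union, so stage `α + 1` is `Γ` applied to the
  -- closure itself.
  have hU : ⋃ β : Set.Iio (Order.succ α), inductiveStage Γ β.1 = inductiveClosure Γ := by
    refine Set.Subset.antisymm ?_ (hα ▸
      Set.subset_iUnion (fun β : Set.Iio (Order.succ α) => inductiveStage Γ β.1)
        ⟨α, Order.lt_succ α⟩)
    refine (hΓ _).trans ?_
    rw [← inductiveStage.eq_def Γ (Order.succ α), h]
  rw [inductiveStage.eq_def, hU] at h
  exact Set.subset_union_right.trans h.subset

/-- A property that one step of a set operator preserves holds of the inductive closure. -/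
theorem inductiveClosure_subset {F : Set ℕ → Set ℕ} {B : Set ℕ} (h : ∀ A, A ⊆ B → F A ⊆ B) :
    (inductiveClosure fun A => A ∪ F A) ⊆ B := by
  have : ∀ α : Ordinal.{0}, inductiveStage (fun A => A ∪ F A) α ⊆ B := by
    intro α
    induction α using WellFoundedLT.induction with
    | ind α ih =>
      rw [inductiveStage.eq_def]
      have hA := Set.iUnion_subset fun β : Set.Iio α => ih β.1 β.2
      exact Set.union_subset hA (h _ hA)
  exact this _

/-- The closed ball with number `s`. -/
def codedBall (s : ℕ) : Set ℝ :=
  Metric.closedBall (ratOfCode s.unpair.1 : ℝ) (1 / 2 ^ s.unpair.2)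

/-- The pairs of a ball `s` and a number `n` such that `s` is not included in `U n`. -/
def nonSubballs (U : ℕ → Set ℝ) : Set ℕ := {t | ¬ codedBall t.unpair.1 ⊆ U t.unpair.2}

variable {U : ℕ → Set ℝ} {A : Set ℕ}

/-- Around a rational point of `U n` near the old centre there is a closed ball inside `U n`. The
assumption on `A` keeps it from being excluded, so the search has a solution and its minimum is
genuine. -/
theorem nextBall_spec (hU : ∀ n, IsOpen (U n)) (hd : ∀ n, Dense (U n)) (hA : A ⊆ nonSubballs U)
    (n s : ℕ) : (s.unpair.2 < (nextBall (charFun A) n s).unpair.2 ∧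
      |ratOfCode s.unpair.1 - ratOfCode (nextBall (charFun A) n s).unpair.1| <
        1 / 2 ^ (s.unpair.2 + 1)) ∧ Nat.pair (nextBall (charFun A) n s) n ∉ A := by
  obtain ⟨q, hq⟩ : ∃ q : ℚ, (q : ℝ) ∈ U n ∩
      Metric.ball (ratOfCode s.unpair.1 : ℝ) (1 / 2 ^ (s.unpair.2 + 1)) :=
    Rat.denseRange_cast.exists_mem_open ((hU n).inter Metric.isOpen_ball)
      ((hd n).inter_open_nonempty _ Metric.isOpen_ball ⟨_, Metric.mem_ball_self (by positivity)⟩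
        |>.mono fun x hx => ⟨hx.2, hx.1⟩)
  obtain ⟨ε, hε, hsub⟩ := Metric.isOpen_iff.1 (hU n) q hq.1
  obtain ⟨m, hm⟩ := exists_pow_lt_of_lt_one hε (one_half_lt_one (α := ℝ))
  obtain ⟨c, rfl⟩ := ratOfCode_surjective q
  have hne : {b | (s.unpair.2 < b.unpair.2 ∧
      |ratOfCode s.unpair.1 - ratOfCode b.unpair.1| < 1 / 2 ^ (s.unpair.2 + 1)) ∧
        charFun A (Nat.pair b n) = 0}.Nonempty := by
    -- The exponent `m` puts the ball inside `U n`; `s.unpair.2 + 1` makes it smaller than `s`.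
    refine ⟨Nat.pair c (max m (s.unpair.2 + 1)), ⟨?_, ?_⟩, ?_⟩
    · simp
    · have := hq.2
      rw [Metric.mem_ball', Real.dist_eq] at this
      rw [← Rat.cast_lt (K := ℝ)]
      simpa using this
    · rw [charFun, if_neg]
      intro hmem
      refine hA hmem ?_
      simp only [Nat.unpair_pair, codedBall]
      refine (Metric.closedBall_subset_ball (lt_of_le_of_lt ?_ hm)).trans hsub
      rw [← one_div_pow]
      exact pow_le_pow_of_le_one (by norm_num) (by norm_num) (le_max_left _ _)
  have : nextBall (charFun A) n s ∈ _ := Nat.sInf_mem hne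
  refine ⟨this.1, fun hmem => ?_⟩
  have h0 := this.2
  rw [charFun, if_pos hmem] at h0
  exact one_ne_zero h0

/-- The new radius and the distance of the centres are each at most half the old radius. -/
theorem codedBall_subset {s b : ℕ} (h : s.unpair.2 < b.unpair.2)
    (h' : |ratOfCode s.unpair.1 - ratOfCode b.unpair.1| < 1 / 2 ^ (s.unpair.2 + 1)) :
    codedBall b ⊆ codedBall s := by
  refine Metric.closedBall_subset_closedBall' ?_
  rw [dist_comm, Real.dist_eq]
  have h₁ : |(ratOfCode s.unpair.1 : ℝ) - ratOfCode b.unpair.1| < 1 / 2 ^ (s.unpair.2 + 1) := by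
    have := (Rat.cast_lt (K := ℝ)).2 h'
    simpa using this
  have h₂ : (1 : ℝ) / 2 ^ b.unpair.2 ≤ 1 / 2 ^ (s.unpair.2 + 1) :=
    one_div_le_one_div_of_le (by positivity) (pow_le_pow_right₀ one_le_two h)
  have h₃ : (1 : ℝ) / 2 ^ s.unpair.2 = 1 / 2 ^ (s.unpair.2 + 1) + 1 / 2 ^ (s.unpair.2 + 1) := by
    rw [pow_succ]; field_simp; norm_num
  linarith

/-- The limit of the centres is in all the balls. -/
theorem realOfCode_centreSeq_mem (hU : ∀ n, IsOpen (U n)) (hd : ∀ n, Dense (U n))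
    (hA : A ⊆ nonSubballs U) (n : ℕ) :
    realOfCode (centreSeq (charFun A)) ∈ codedBall (ballSeq (charFun A) (n + 1)) := by
  have spec : ∀ m, _ := fun m => nextBall_spec hU hd hA m (ballSeq (charFun A) m)
  have hrad : ∀ m, m ≤ (ballSeq (charFun A) m).unpair.2 := by
    intro m
    induction m with
    | zero => exact Nat.zero_le _
    | succ m ih => exact ih.trans_lt (spec m).1.1
  have hanti : Antitone fun m => codedBall (ballSeq (charFun A) m) :=
    antitone_nat_of_succ_le fun m => codedBall_subset (spec m).1.1 (spec m).1.2
  have hfast : ∀ k, |ratOfCode (centreSeq (charFun A) k) -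
      ratOfCode (centreSeq (charFun A) (k + 1))| < 1 / 2 ^ (k + 1) := fun k =>
    (spec (k + 1)).1.2.trans_le (one_div_le_one_div_of_le (by positivity)
      (pow_le_pow_right₀ one_le_two ((hrad (k + 1)).trans (Nat.le_succ _))))
  -- Fast convergence makes the hat function act as the identity, so the coded real is the actual
  -- limit of the centres.
  have hhat : ∀ m, hatSeq (fun k => ratOfCode (centreSeq (charFun A) k)) m =
      ratOfCode (centreSeq (charFun A) m) := by
    rintro (- | m)
    · rfl
    · exact if_pos fun k _ => hfast k
  have ht := tendsto_realOfCode (centreSeq (charFun A))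
  simp only [hhat] at ht
  refine Metric.isClosed_closedBall.mem_of_tendsto ht
    (Filter.eventually_atTop.2 ⟨n, fun m hm => ?_⟩)
  exact hanti (Nat.succ_le_succ hm) (Metric.mem_closedBall_self (by positivity))

/-- By extensionality it is enough to test one code, as `exclusion` does. -/
theorem realOfCode_mem_representedSet_iff {Φ : (ℕ → ℕ) → (ℕ → ℕ)} (hΦ : RepresentsRealFunction Φ)
    (f : ℕ → ℕ) : realOfCode f ∈ representedSet Φ ↔ 0 < realOfCode (Φ f) :=
  ⟨fun ⟨g, hg, hpos⟩ => hΦ g f hg ▸ hpos, fun h => ⟨f, rfl, h⟩⟩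

end Correctness

theorem theorem6p5 :
    ∃ ξ : (ℕ → (ℕ → ℕ) → (ℕ → ℕ)) → (ℕ → ℕ),
      KleeneComputableIn existsTwo IND ξ ∧
      ∀ Y : ℕ → (ℕ → ℕ) → (ℕ → ℕ),
        (∀ n, RepresentsRealFunction (Y n)) →
        (∀ n, IsOpen (representedSet (Y n))) →
        (∀ n, Dense (representedSet (Y n))) →
        realOfCode (ξ Y) ∈ ⋂ n, representedSet (Y n) := by
  refine ⟨_, kleeneComputableIn_centreSeq_IND, fun Y hY hU hd => Set.mem_iInter.2 fun n => ?_⟩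
  set F : Set ℕ → Set ℕ := fun A => {t | 0 < exclusion Y (charFun A) t}
  have hF : ∀ A t, t ∈ F A ↔ t.unpair.1 = ballSeq (charFun A) (t.unpair.2 + 1) ∧
      realOfCode (centreSeq (charFun A)) ∉ representedSet (Y t.unpair.2) := by
    intro A t
    rw [realOfCode_mem_representedSet_iff (hY _)]
    change 0 < exclusion Y (charFun A) t ↔ _
    unfold exclusion
    split_ifs with h
    · exact iff_of_true one_pos h
    · exact iff_of_false (lt_irrefl 0) h
  have hsub : (inductiveClosure fun A => A ∪ F A) ⊆ nonSubballs fun n => representedSet (Y n) := by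
    refine inductiveClosure_subset fun A hA t ht hball => ?_
    obtain ⟨h₁, h₂⟩ := (hF A t).1 ht
    -- The limit lies in the ball being excluded; were that ball a subset of the represented set,
    -- the limit would belong to it.
    exact h₂ (hball (h₁ ▸ realOfCode_centreSeq_mem hU hd hA _))
  have hIND : IND (exclusion Y) = charFun (inductiveClosure fun A => A ∪ F A) := rfl
  rw [hIND]
  by_contra hn
  -- The ball chosen at `n`, which is number `n + 1` of the sequence, is not excluded by the
  -- closure; but if the limit misses `Y n`, the operator excludes it, and the closure is closed.
  refine (nextBall_spec hU hd hsub n (ballSeq (charFun (inductiveClosure fun A => A ∪ F A)) n)).2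
    (subset_inductiveClosure F ((hF _ _).2 ?_))
  simp only [Nat.unpair_pair]
  exact ⟨rfl, hn⟩
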